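/- Let $(W,S)$ be a Coxeter system with Coxeter graph $\Gamma$ (the set $S$ and the group $W$ may be infinite, and labels $\infty$ are allowed). Let $X_\Gamma=\{wsw^{-1} : w\in W,\ s\in S\}$ be its Coxeter quandle, that is, the set of reflections of $W$ with the operation $x\lhd y=y^{-1}xy$. The adjoint group $\mathrm{As}(X_\Gamma)=\langle e_x\ (x\in X_\Gamma)\mid e_{x\lhd y}=e_y^{-1}e_xe_y\ (x,y\in X_\Gamma)\rangle$ acts on $X_\Gamma$ from the right by $x\cdot e_y=x\lhd y$. If $X_\Gamma$ is connected, i.e. if this action is transitive, then the second homology group $H_2^{\mathrm{gr}}(W)=H_2(W;\mathbb Z)$ with trivial integral coefficients is annihilated by $2$: $2a=0$ for every $a\in H_2^{\mathrm{gr}}(W)$. -/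

import Mathlib

universe u v

/-- The Coxeter quandle of a Coxeter system: the set of reflections, i.e. of the elements of `W`
that are conjugate to a simple generator. -/
def CoxeterQuandle {B : Type v} {M : CoxeterMatrix B} {W : Type u} [Group W]
    (cs : CoxeterSystem M W) : Type u :=
  {t : W // cs.IsReflection t}

/-- The conjugation operation on reflections. In Mathlib's convention for quandles the acting
element stands on the left: `act t t'` is the element written `t' ◁ t` in the convention for
right quandles, and equals `t * t' * t⁻¹ = t⁻¹ * t' * t` since `t` is an involution. -/
instance CoxeterQuandle.instQuandle {B : Type v} {M : CoxeterMatrix B} {W : Type u} [Group W]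
    (cs : CoxeterSystem M W) : Quandle (CoxeterQuandle cs) where
  act t t' := ⟨t.1 * t'.1 * t.1⁻¹, t'.2.conj t.1⟩
  self_distrib := by
    intro x y z
    apply Subtype.ext
    simp [mul_assoc]
  invAct t t' := ⟨t.1⁻¹ * t'.1 * t.1, by simpa using t'.2.conj t.1⁻¹⟩
  left_inv t t' := by
    apply Subtype.ext
    simp [mul_assoc]
  right_inv t t' := by
    apply Subtype.ext
    simp [mul_assoc]
  fix := by
    intro x
    apply Subtype.ext
    simp

/-- A quandle is connected if its adjoint group (enveloping group: one generator for each element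
of `X`, with the conjugation relations) acts transitively on it. -/
def QuandleIsConnected (X : Type u) [Quandle X] : Prop :=
  ∀ x y : X, ∃ g : Rack.EnvelGroup X, Rack.envelAction g x = y

/-- The homology `H_n(G; ℤ)` of a group `G` with trivial integral coefficients. Mathlib wants the
coefficient ring in the universe of `G`, so `ℤ` is lifted to that universe. -/
noncomputable abbrev integralGroupHomology (G : Type u) [Group G] (n : ℕ) :
    ModuleCat.{u} (ULift.{u} ℤ) :=
  groupHomology (Rep.trivial (ULift.{u} ℤ) G (ULift.{u} ℤ)) n

/-! Characters into ℚ/ℤ detect elements of `H₂(W; ℤ)`, so it suffices that `2c` is a coboundary for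
every ℚ/ℤ-valued 2-cocycle `c`, i.e. that the central extension defined by `2c` splits. Doubling
makes commutation with an involution lift (`two_nsmul_comm`), and divisibility of ℚ/ℤ lifts one
simple generator to an involution. Connectedness carries this lift to all simple generators by
conjugation, consistently because centralizers lift. The Coxeter relations then hold because each
says that one reflection is a conjugate of another (`exists_splitting`). -/

section Conjugacy

variable {B : Type v} {M : CoxeterMatrix B} {W : Type u} [Group W]

/-- The adjoint group of the Coxeter quandle acts through conjugation by elements of `W`. -/
theorem CoxeterQuandle.exists_envelAction_eq_conj (cs : CoxeterSystem M W)
    (g : Rack.EnvelGroup (CoxeterQuandle cs)) :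
    ∃ w : W, ∀ x, (Rack.envelAction g x).1 = w * x.1 * w⁻¹ := by
  induction g using Quotient.inductionOn with
  | h p =>
    induction p with
    | unit =>
      refine ⟨1, fun x => ?_⟩
      rw [one_mul, inv_one, mul_one]
      rfl
    | incl y => exact ⟨y.1, fun x => rfl⟩
    | mul p q hp hq =>
      obtain ⟨v, hv⟩ := hp
      obtain ⟨w, hw⟩ := hq
      refine ⟨v * w, fun x => ?_⟩
      have h : Rack.envelAction (⟦p.mul q⟧ : Rack.EnvelGroup (CoxeterQuandle cs)) x =
          Rack.envelAction (⟦p⟧ : Rack.EnvelGroup (CoxeterQuandle cs))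
            (Rack.envelAction (⟦q⟧ : Rack.EnvelGroup (CoxeterQuandle cs)) x) := rfl
      rw [h, hv, hw]
      group
    | inv p hp =>
      obtain ⟨v, hv⟩ := hp
      refine ⟨v⁻¹, fun x => ?_⟩
      set y := Rack.envelAction (⟦p.inv⟧ : Rack.EnvelGroup (CoxeterQuandle cs)) x with hy
      have h : Rack.envelAction (⟦p⟧ : Rack.EnvelGroup (CoxeterQuandle cs)) y = x := by
        exact Equiv.apply_symm_apply
          (Rack.envelAction (⟦p⟧ : Rack.EnvelGroup (CoxeterQuandle cs))) x
      rw [← h, hv]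
      group

/-- In a Coxeter system with connected Coxeter quandle all simple generators are conjugate. -/
theorem CoxeterSystem.isConj_simple_of_connected (cs : CoxeterSystem M W)
    (hX : QuandleIsConnected (CoxeterQuandle cs)) (i j : B) :
    ∃ w : W, w * cs.simple i * w⁻¹ = cs.simple j := by
  obtain ⟨g, hg⟩ := hX ⟨cs.simple i, cs.isReflection_simple i⟩
    ⟨cs.simple j, cs.isReflection_simple j⟩
  obtain ⟨w, hw⟩ := CoxeterQuandle.exists_envelAction_eq_conj cs g
  refine ⟨w, ?_⟩
  have h := hw ⟨cs.simple i, cs.isReflection_simple i⟩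
  rw [hg] at h
  exact h.symm

end Conjugacy

section Splitting

/-- The involution `a` inverts `a * b`. This turns dihedral relations into conjugacy relations. -/
theorem mul_pow_conj_eq {G : Type*} [Group G] {a b : G} (ha : a * a = 1) (hb : b * b = 1)
    (k : ℕ) : (a * b) ^ k * a * ((a * b) ^ k)⁻¹ = (a * b) ^ (2 * k) * a := by
  have h : a * ((a * b) ^ k)⁻¹ = (a * b) ^ k * a := by
    have hinv : (a * b)⁻¹ = b * a := by
      rw [mul_inv_rev, inv_eq_of_mul_eq_one_right ha, inv_eq_of_mul_eq_one_right hb]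
    rw [← inv_pow, hinv]
    exact SemiconjBy.pow_right (show SemiconjBy a (b * a) (a * b) from (mul_assoc a b a).symm) k
  rw [mul_assoc, h, ← mul_assoc, ← pow_add, two_mul]

/-- Let `π : E → W` be an extension of a Coxeter group all of whose simple generators are
conjugate. If commutation with involutions lifts along `π` and every element of the kernel is a
square in the kernel, then the extension splits. -/
theorem CoxeterSystem.exists_splitting {B : Type*} {M : CoxeterMatrix B} {W E : Type*} [Group W]
    [Group E] (cs : CoxeterSystem M W) (π : E →* W) (hπ : Function.Surjective π)
    (hcomm : ∀ x y, π x * π x = 1 → Commute (π x) (π y) → Commute x y)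
    (hsq : ∀ z, π z = 1 → ∃ d, π d = 1 ∧ d * d = z)
    (hconj : ∀ i j, ∃ w : W, w * cs.simple i * w⁻¹ = cs.simple j) :
    ∃ σ : W →* E, ∀ w, π (σ w) = w := by
  suffices h : ∃ f : B → E, (∀ i, π (f i) = cs.simple i) ∧ M.IsLiftable f by
    obtain ⟨f, hf, hl⟩ := h
    refine ⟨cs.lift ⟨f, hl⟩, fun w => ?_⟩
    have : π.comp (cs.lift ⟨f, hl⟩) = MonoidHom.id W :=
      cs.ext_simple fun i => by simp [cs.lift_apply_simple hl, hf]
    exact DFunLike.congr_fun this w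
  rcases isEmpty_or_nonempty B with hB | ⟨⟨i₀⟩⟩
  · exact ⟨isEmptyElim, isEmptyElim, isEmptyElim⟩
  obtain ⟨e, he, hee⟩ : ∃ e, π e = cs.simple i₀ ∧ e * e = 1 := by
    obtain ⟨x, hx⟩ := hπ (cs.simple i₀)
    obtain ⟨d, hd, hdx⟩ := hsq (x * x) (by simp [hx])
    -- Since `1 * 1 = 1`, `hcomm` also makes the kernel central.
    have hc : Commute d x := hcomm d x (by simp [hd]) (by simp [hd])
    refine ⟨x * d⁻¹, by simp [hx, hd], ?_⟩
    calc x * d⁻¹ * (x * d⁻¹) = x * x * (d * d)⁻¹ := by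
          rw [mul_assoc, ← mul_assoc d⁻¹ x, hc.inv_left.eq]; group
      _ = 1 := by rw [hdx, mul_inv_cancel]
  have hlift : ∀ i, ∃ g : E, π g * cs.simple i₀ * (π g)⁻¹ = cs.simple i := fun i => by
    obtain ⟨w, hw⟩ := hconj i₀ i
    obtain ⟨g, rfl⟩ := hπ w
    exact ⟨g, hw⟩
  choose u hu using hlift
  let f : B → E := fun i => u i * e * (u i)⁻¹
  have hf : ∀ i, π (f i) = cs.simple i := fun i => by simp [f, he, hu]
  have hff : ∀ i, f i * f i = 1 := fun i => by
    calc f i * f i = u i * (e * e) * (u i)⁻¹ := by simp only [f]; group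
      _ = 1 := by simp [hee]
  -- Conjugacies between the chosen lifts can be tested in `W`: `(u j)⁻¹ * g * u i` centralizes
  -- `cs.simple i₀` there, hence commutes with `e`.
  have key : ∀ (i j : B) (g : E), π g * cs.simple i * (π g)⁻¹ = cs.simple j →
      g * f i * g⁻¹ = f j := by
    intro i j g hg
    have hc : Commute e ((u j)⁻¹ * g * u i) := by
      refine hcomm _ _ (by simp [he]) ?_
      rw [he]
      have : π g * (π (u i) * cs.simple i₀ * (π (u i))⁻¹) * (π g)⁻¹ =
          π (u j) * cs.simple i₀ * (π (u j))⁻¹ := by rw [hu, hu, hg]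
      have h2 : cs.simple i₀ = (π (u j))⁻¹ * (π g * (π (u i) * cs.simple i₀ * (π (u i))⁻¹) *
          (π g)⁻¹) * π (u j) := by rw [this]; group
      change _ * _ = _ * _
      conv_lhs => rw [h2]
      simp only [map_mul, map_inv]
      group
    calc g * f i * g⁻¹ = u j * (((u j)⁻¹ * g * u i) * e) * (u i)⁻¹ * g⁻¹ := by
          simp only [f]; group
      _ = f j := by rw [← hc.eq]; simp only [f]; group
  refine ⟨f, hf, fun i j => ?_⟩
  have hm := cs.simple_mul_simple_pow i j
  have hconjW := fun k => mul_pow_conj_eq (cs.simple_mul_simple_self i)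
    (cs.simple_mul_simple_self j) k
  -- Conjugation by `(f i * f j) ^ k` fixes `f i` for `M i j = 2k` and sends it to `f j` for `M i j
  -- = 2k + 1`. The label `∞`, encoded as `0`, is the even case `k = 0`.
  obtain ⟨k, hk | hk⟩ := Nat.even_or_odd' (M i j)
  · have h := key i i ((f i * f j) ^ k) (by
      rw [map_pow, map_mul, hf, hf, hconjW, ← hk, hm, one_mul])
    rw [mul_pow_conj_eq (hff i) (hff j)] at h
    rw [hk]
    exact mul_eq_right.mp h
  · rw [hk, pow_succ, ← mul_assoc] at hm
    have h := key i j ((f i * f j) ^ k) (by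
      rw [map_pow, map_mul, hf, hf, hconjW, eq_inv_of_mul_eq_one_left hm, cs.inv_simple])
    rw [mul_pow_conj_eq (hff i) (hff j)] at h
    rw [hk, pow_succ, ← mul_assoc, h, hff]

end Splitting

section CentralExtension

/-- The inhomogeneous 2-cocycle condition for trivial coefficients. -/
def IsTrivialCoeffCocycle {G A : Type*} [Group G] [AddCommGroup A] (c : G → G → A) : Prop :=
  ∀ g h k, c g h + c (g * h) k = c h k + c g (h * k)

variable {G A : Type*} [Group G] [AddCommGroup A] {c : G → G → A}

namespace IsTrivialCoeffCocycle

theorem map_one_left (hc : IsTrivialCoeffCocycle c) (g : G) : c 1 g = c 1 1 := by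
  simpa using (hc 1 1 g).symm

theorem map_one_right (hc : IsTrivialCoeffCocycle c) (g : G) : c g 1 = c 1 1 := by
  simpa using hc g 1 1

theorem nsmul (hc : IsTrivialCoeffCocycle c) (n : ℕ) :
    IsTrivialCoeffCocycle fun g h => n • c g h := fun g h k => by
  simp only [← smul_add, hc g h k]

/-- A cocycle is symmetric up to 2-torsion on commuting pairs that contain an involution. -/
theorem two_nsmul_comm (hc : IsTrivialCoeffCocycle c) {s g : G} (hs : s * s = 1)
    (hsg : s * g = g * s) : 2 • c s g = 2 • c g s := by
  -- The outer two identities express `c s (g * s)` and `c (g * s) s` through `c s g` and `c g s`;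
  -- the middle one compares them.
  have h1 := hc s s g
  have h2 := hc s g s
  have h3 := hc g s s
  rw [hs, hc.map_one_left] at h1
  rw [hs, hc.map_one_right] at h3
  rw [hsg] at h1 h2
  have e1 : c s (g * s) = c s s + c 1 1 - c s g := by rw [h1]; abel
  have e3 : c (g * s) s = c s s + c 1 1 - c g s := by rw [← h3]; abel
  rw [e1, e3] at h2
  have h4 : 2 • c s g - 2 • c g s =
      (c s g + (c s s + c 1 1 - c g s)) - (c g s + (c s s + c 1 1 - c s g)) := by abel
  rw [← sub_eq_zero, h4, h2, sub_self]

end IsTrivialCoeffCocycle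

/-- The central extension of `G` by `A` defined by a 2-cocycle. -/
@[ext]
structure CocycleExtension (hc : IsTrivialCoeffCocycle c) where
  /-- the component in the kernel -/
  fst : A
  /-- the component in the quotient -/
  snd : G

namespace CocycleExtension

variable (hc : IsTrivialCoeffCocycle c)

instance : Mul (CocycleExtension hc) :=
  ⟨fun x y => ⟨x.fst + y.fst + c x.snd y.snd, x.snd * y.snd⟩⟩

/-- The cocycle is not assumed normalized, hence the correction by `c 1 1`. -/
instance : One (CocycleExtension hc) := ⟨⟨-c 1 1, 1⟩⟩

instance : Inv (CocycleExtension hc) :=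
  ⟨fun x => ⟨-x.fst - c x.snd⁻¹ x.snd - c 1 1, x.snd⁻¹⟩⟩

variable {hc}

@[simp] theorem mul_fst (x y : CocycleExtension hc) :
    (x * y).fst = x.fst + y.fst + c x.snd y.snd := rfl

@[simp] theorem mul_snd (x y : CocycleExtension hc) : (x * y).snd = x.snd * y.snd := rfl

@[simp] theorem one_fst : (1 : CocycleExtension hc).fst = -c 1 1 := rfl

@[simp] theorem one_snd : (1 : CocycleExtension hc).snd = 1 := rfl

@[simp] theorem inv_fst (x : CocycleExtension hc) :
    x⁻¹.fst = -x.fst - c x.snd⁻¹ x.snd - c 1 1 := rfl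

@[simp] theorem inv_snd (x : CocycleExtension hc) : x⁻¹.snd = x.snd⁻¹ := rfl

instance : Group (CocycleExtension hc) :=
  Group.ofLeftAxioms
    (fun x y z => by
      ext
      · have h := hc x.snd y.snd z.snd
        calc x.fst + y.fst + c x.snd y.snd + z.fst + c (x.snd * y.snd) z.snd
            = x.fst + y.fst + z.fst + (c x.snd y.snd + c (x.snd * y.snd) z.snd) := by abel
          _ = x.fst + (y.fst + z.fst + c y.snd z.snd) + c x.snd (y.snd * z.snd) := by
            rw [h]; abel
      · exact mul_assoc _ _ _)
    (fun x => by
      ext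
      · simp [hc.map_one_left]
      · simp)
    (fun x => by
      ext
      · simp only [mul_fst, inv_fst, inv_snd, one_fst]
        abel
      · simp)

variable (hc) in
/-- The projection of the central extension onto its quotient. -/
def proj : CocycleExtension hc →* G where
  toFun := snd
  map_one' := rfl
  map_mul' _ _ := rfl

@[simp] theorem proj_apply (x : CocycleExtension hc) : proj hc x = x.snd := rfl

end CocycleExtension

/-- Twice a 2-cocycle with values in a 2-divisible trivial module is a coboundary on every Coxeter
group whose simple generators are all conjugate. -/
theorem CoxeterSystem.exists_two_nsmul_cocycle_eq {B : Type*} {M : CoxeterMatrix B}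
    (cs : CoxeterSystem M G) (hconj : ∀ i j, ∃ w : G, w * cs.simple i * w⁻¹ = cs.simple j)
    (hA : ∀ a : A, ∃ b, b + b = a) (hc : IsTrivialCoeffCocycle c) :
    ∃ f : G → A, ∀ g h, 2 • c g h = f h - f (g * h) + f g := by
  have hc2 := hc.nsmul 2
  obtain ⟨σ, hσ⟩ := cs.exists_splitting (CocycleExtension.proj hc2) (fun g => ⟨⟨0, g⟩, rfl⟩)
    (fun x y hx hxy => by
      ext
      · simp only [CocycleExtension.mul_fst]
        rw [add_comm x.fst]
        exact congrArg _ (hc.two_nsmul_comm hx hxy)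
      · exact hxy)
    (fun z hz => by
      -- The square of `(b, 1)` has first component `b + b + 2 • c 1 1`.
      obtain ⟨b, hb⟩ := hA (z.fst - 2 • c 1 1)
      refine ⟨⟨b, 1⟩, rfl, ?_⟩
      ext
      · simp [hb]
      · simpa using! hz.symm) hconj
  refine ⟨fun g => -(σ g).fst, fun g h => ?_⟩
  have h1 := congrArg CocycleExtension.fst (map_mul σ g h)
  rw [CocycleExtension.mul_fst] at h1
  have h2 : ∀ w, (σ w).snd = w := hσ
  rw [h2, h2] at h1
  simp only [h1]
  abel

end CentralExtension

section Homology

open groupHomology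

/-- If twice every 2-cocycle on `G` with values in the trivial module `ℚ/ℤ` is a coboundary, then
`H₂(G; ℤ)` is annihilated by `2`. -/
theorem two_nsmul_integralGroupHomology_two_eq_zero {G : Type u} [Group G]
    (h : ∀ c : G → G → AddCircle (1 : ℚ), IsTrivialCoeffCocycle c →
      ∃ f : G → AddCircle (1 : ℚ), ∀ g h, 2 • c g h = f h - f (g * h) + f g)
    (a : integralGroupHomology G 2) : (2 : ℕ) • a = 0 := by
  let A := Rep.trivial (ULift.{u} ℤ) G (ULift.{u} ℤ)
  induction a using H2_induction_on with
  | h z =>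
  rw [← map_nsmul]
  refine (H2π_eq_zero_iff _).2 ?_
  rw [← Submodule.Quotient.mk_eq_zero]
  -- A character of 2-chains modulo boundaries is a 2-cocycle once evaluated on the basis.
  refine CharacterModule.eq_zero_of_character_apply fun χ => ?_
  let Φ : (G × G →₀ A) →+ AddCircle (1 : ℚ) :=
    AddMonoidHom.comp (χ : _ →+ AddCircle (1 : ℚ)) (boundaries₂ A).mkQ.toAddMonoidHom
  have hΦ : ∀ y, Φ (d₃₂ A y) = 0 := fun y => by
    have : (boundaries₂ A).mkQ (d₃₂ A y) = 0 := by
      rw [Submodule.mkQ_apply, Submodule.Quotient.mk_eq_zero]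
      exact ⟨y, rfl⟩
    change χ ((boundaries₂ A).mkQ (d₃₂ A y)) = 0
    rw [this]
    exact map_zero (χ : _ →+ AddCircle (1 : ℚ))
  let o : A := (ULift.up 1 : ULift.{u} ℤ)
  obtain ⟨f, hf⟩ := h (fun g h => Φ (Finsupp.single (g, h) o)) fun g h k => by
    have := hΦ (Finsupp.single (g, h, k) o)
    rw [d₃₂_single] at this
    simp only [map_sub, map_add] at this
    have h1 : A.ρ g⁻¹ o = o := rfl
    rw [h1] at this
    rw [← sub_eq_zero, ← neg_eq_zero, ← this]
    abel
  let Ψ : (G →₀ A) →+ AddCircle (1 : ℚ) := Finsupp.liftAddHom fun g =>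
    ((zmultiplesHom _ (f g)).comp AddEquiv.ulift.toAddMonoidHom : ULift.{u} ℤ →+ _)
  -- The coboundary formula makes `2 • Φ` factor through `d₂₁`, so it vanishes on cycles.
  have hΨ : 2 • Φ = Ψ.comp (d₂₁ A).hom.toAddMonoidHom := by
    refine Finsupp.addHom_ext fun g n => ?_
    have hn : n = (ULift.down n : ℤ) • o :=
      ULift.ext _ _ (mul_one (ULift.down n : ℤ)).symm
    have hs : Finsupp.single g n = (ULift.down n : ℤ) • Finsupp.single g o := by
      rw [Finsupp.smul_single, ← hn]
    have hΨo : ∀ x, Ψ (Finsupp.single x o) = f x := fun x => by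
      have h1 : Ψ (Finsupp.single x o) = (1 : ℤ) • f x := by
        simp only [Ψ, Finsupp.liftAddHom_apply_single]
        rfl
      rw [h1, one_smul]
    rw [hs, map_zsmul, map_zsmul]
    congr 1
    change 2 • Φ (Finsupp.single g o) = Ψ (d₂₁ A (Finsupp.single g o))
    have h1 : A.ρ g.1⁻¹ o = o := rfl
    rw [d₂₁_single, h1, map_add, map_sub, hΨo, hΨo, hΨo]
    exact hf g.1 g.2
  have hz : (d₂₁ A).hom z.1 = 0 := z.2
  change Φ ((2 • z : cycles₂ A) : G × G →₀ A) = 0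
  have h2 : 2 • Φ z.1 = Ψ ((d₂₁ A).hom z.1) := DFunLike.congr_fun hΨ z.1
  rw [hz, map_zero] at h2
  exact (map_nsmul Φ 2 z.1).trans h2

end Homology

theorem theorem4p10 {B : Type v} {M : CoxeterMatrix B} {W : Type u} [Group W]
    (cs : CoxeterSystem M W) (hX : QuandleIsConnected (CoxeterQuandle cs))
    (a : integralGroupHomology W 2) :
    (2 : ℕ) • a = 0 :=
  two_nsmul_integralGroupHomology_two_eq_zero
    (fun _ hc => cs.exists_two_nsmul_cocycle_eq (cs.isConj_simple_of_connected hX)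
      (fun a => ⟨DivisibleBy.div a (2 : ℤ), by
        rw [← two_zsmul]; exact DivisibleBy.div_cancel a two_ne_zero⟩) hc) a
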